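/- Let $G$ be a group, let $g,h\in G$, and suppose that $G$ has a $(g,h)$-wS-subset, i.e. a subset $E\subseteq G$ for which there exist elements $a\neq b$ of $E$ with $gE=E\smallsetminus\{a\}$ and $hE=E\smallsetminus\{b\}$. Let $H=\langle g,h\rangle$ be the subgroup generated by $g$ and $h$. Then either $H$ is free over the pair $(g,h)$ (that is, the homomorphism from the free group on two generators $x,y$ to $H$ with $x\mapsto g$, $y\mapsto h$ is an isomorphism), or there exists an integer $k\ge 2$ such that $H$ has the presentation $G_k=\langle g,h\mid (h^{-1}g)^k\rangle$ (that is, $x\mapsto g$, $y\mapsto h$ induces an isomorphism from $\langle x,y\mid (y^{-1}x)^k\rangle$ onto $H$). -/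

import Mathlib

open scoped Pointwise

/-- `E` is a `(g, h)`-wS-subset (weak Sierpiński subset with respect to `g` and `h`) of `G`:
there are `a ≠ b` in `E` with `gE = E \ {a}` and `hE = E \ {b}`. -/
def IsWSSubset {G : Type*} [Group G] (g h : G) (E : Set G) : Prop :=
  ∃ a ∈ E, ∃ b ∈ E, a ≠ b ∧ g • E = E \ {a} ∧ h • E = E \ {b}

/-- The subgroup generated by `g` and `h` has the presentation `⟨x₀, x₁ | rels⟩`, with the
generator `x₀` corresponding to `g` and the generator `x₁` to `h`. -/
def PairHasPresentation {G : Type*} [Group G] (g h : G) (rels : Set (FreeGroup (Fin 2))) : Prop :=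
  ∃ e : PresentedGroup rels ≃* Subgroup.closure ({g, h} : Set G),
    (e (PresentedGroup.of 0) : G) = g ∧ (e (PresentedGroup.of 1) : G) = h

/-- The subgroup generated by `g` and `h` is free over the pair `(g, h)`. -/
def PairIsFree {G : Type*} [Group G] (g h : G) : Prop :=
  ∃ e : FreeGroup (Fin 2) ≃* Subgroup.closure ({g, h} : Set G),
    (e (FreeGroup.of 0) : G) = g ∧ (e (FreeGroup.of 1) : G) = h

/-!
Passing to inverses, a wS-subset becomes a set `X` of vertices of the Cayley graph of `(G, g, h)`
whose boundary consists of two outgoing edges, one for each generator.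

Suppose that `g` and `h` satisfy a nontrivial relation. If a translate of a shortest closed walk
leaves `X` through one boundary edge, then, being shortest, it comes back through the other one, and
the length `L` of the arc in between depends neither on the walk nor on the edge. Two arcs with the
same end points of total length less than that of the walk coincide. Comparing partner arcs, or
their complements if `L` is more than half the length of the walk, one finds that each letter
determines its neighbour on a fixed side, and hence that the shortest relation alternates between
`g` and `h⁻¹`. So `t = g * h⁻¹` has finite order.

The translates of `X` by powers of `t` can then be uncrossed: an intersection of complements of
translates is a set `W` whose two boundary edges enter it at the same vertex. Such a set is
invariant under right multiplication by `t`, and right multiplication by `h` crosses its boundary in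
one edge only, so a closed walk in the letters `h`, `h⁻¹` and the powers of `t` must backtrack.
Therefore the subgroup generated by `g` and `h` is the free product of `⟨t⟩` and the infinite cyclic
group `⟨h⟩`.
-/

/-- Right translation by `g` leaves `X` only from `a`, and never enters `X`: in the Cayley graph
with edges `y → y * g`, the boundary of `X` consists of the outgoing edge at `a`. Right translations
replace the left ones of `IsWSSubset`, which amounts to passing from `E` to its inverse. -/
def LeavesOnlyAt {G : Type*} [Group G] (g : G) (X : Set G) (a : G) : Prop :=
  ∀ y, y * g ∈ X ↔ y ∈ X ∧ y ≠ a

theorem leavesOnlyAt_of_smul_eq {G : Type*} [Group G] {g a : G} {E : Set G}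
    (h : g • E = E \ {a}) (d : G) : LeavesOnlyAt g {y | y⁻¹ * d ∈ E} (d * a⁻¹) := by
  intro y
  have hy : y⁻¹ * d ∈ g • E ↔ y⁻¹ * d ∈ E \ {a} := by rw [h]
  rw [Set.mem_smul_set_iff_inv_smul_mem] at hy
  have ha : y⁻¹ * d = a ↔ y = d * a⁻¹ := by
    rw [inv_mul_eq_iff_eq_mul, eq_mul_inv_iff_mul_eq, eq_comm]
  simpa [mul_assoc, ha] using hy

theorem LeavesOnlyAt.mul_notMem {G : Type*} [Group G] {g a : G} {X : Set G}
    (hg : LeavesOnlyAt g X a) : a * g ∉ X :=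
  fun hmem => ((hg a).1 hmem).2 rfl

theorem LeavesOnlyAt.eq_of_mem_of_mul_notMem {G : Type*} [Group G] {g a y : G} {X : Set G}
    (hg : LeavesOnlyAt g X a) (hy : y ∈ X) (hyg : y * g ∉ X) : y = a :=
  by_contra fun hne => hyg ((hg y).2 ⟨hy, hne⟩)

theorem LeavesOnlyAt.mem_of_mul_mem {G : Type*} [Group G] {g a y : G} {X : Set G}
    (hg : LeavesOnlyAt g X a) (hyg : y * g ∈ X) : y ∈ X :=
  ((hg y).1 hyg).1

section PingPong

theorem exists_step_leaving {M : Type*} [Monoid M] {S : Set M} {p : M} {l : List M} (hp : p ∈ S)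
    (hl : p * l.prod ∉ S) :
    ∃ A s B, l = A ++ s :: B ∧ p * A.prod ∈ S ∧ p * A.prod * s ∉ S := by
  induction l generalizing p with
  | nil => exact absurd (by simpa using hp) hl
  | cons s l ih =>
    by_cases hs : p * s ∈ S
    · obtain ⟨A, t, B, rfl, hA, ht⟩ := ih hs (by simpa [mul_assoc] using hl)
      exact ⟨s :: A, t, B, rfl, by simpa [mul_assoc] using hA, by simpa [mul_assoc] using ht⟩
    · exact ⟨[], s, l, rfl, by simpa using hp, by simpa using hs⟩

variable {Γ G : Type*} [Group Γ] [Group G] {Φ : Γ →* G} {K : Subgroup Γ} {Y : Γ} {X : Set G} {a : G}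

theorem eq_of_letter_leaving (hY : LeavesOnlyAt (Φ Y) X a)
    (hK : ∀ s ∈ K, ∀ y, y * Φ s ∈ X ↔ y ∈ X) {s : Γ} (hs : s = Y ∨ s = Y⁻¹ ∨ s ∈ K) {y : G}
    (hy : y ∈ X) (hys : y * Φ s ∉ X) : s = Y ∧ y = a := by
  rcases hs with rfl | rfl | hs
  · exact ⟨rfl, hY.eq_of_mem_of_mul_notMem hy hys⟩
  · exact absurd (hY.mem_of_mul_mem (by simpa using hy)) hys
  · exact absurd ((hK s hs y).2 hy) hys

theorem eq_of_letter_entering (hY : LeavesOnlyAt (Φ Y) X a)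
    (hK : ∀ s ∈ K, ∀ y, y * Φ s ∈ X ↔ y ∈ X) {s : Γ} (hs : s = Y ∨ s = Y⁻¹ ∨ s ∈ K) {y : G}
    (hy : y ∉ X) (hys : y * Φ s ∈ X) : s = Y⁻¹ ∧ y * Φ s = a := by
  have hs' : s⁻¹ = Y ∨ s⁻¹ = Y⁻¹ ∨ s⁻¹ ∈ K := by
    rw [inv_eq_iff_eq_inv, inv_inj, inv_mem_iff]
    tauto
  simpa [inv_eq_iff_eq_inv] using eq_of_letter_leaving hY hK hs' hys (by simpa using hy)

/-- A closed walk crosses the boundary of `X` an even number of times, and only one edge is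
available for that: a walk that starts with this edge has to use it again, backwards. -/
theorem exists_cancelling_letter (ha : a ∈ X) (hY : LeavesOnlyAt (Φ Y) X a)
    (hK : ∀ s ∈ K, ∀ y, y * Φ s ∈ X ↔ y ∈ X) {r : Γ} (hr : r = Y ∨ r = Y⁻¹) {l : List Γ}
    (hl : ∀ s ∈ l, s = Y ∨ s = Y⁻¹ ∨ s ∈ K) (hΦ : Φ (r * l.prod) = 1) :
    ∃ M D, l = M ++ r⁻¹ :: D ∧ Φ M.prod = 1 := by
  rcases hr with rfl | rfl
  · obtain ⟨M, s, D, rfl, hM, hs⟩ := exists_step_leaving (S := {γ | a * Φ γ ∉ X}) (p := r) (l := l)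
      hY.mul_notMem (by simpa [hΦ] using ha)
    have hs' : a * Φ (r * M.prod) * Φ s ∈ X := by simpa [mul_assoc] using hs
    obtain ⟨rfl, hmul⟩ := eq_of_letter_entering hY hK (hl s (by simp)) hM hs'
    have hconj : Φ r * Φ M.prod * (Φ r)⁻¹ = 1 := by simpa [mul_assoc] using hmul
    exact ⟨M, D, rfl, conj_eq_one_iff.1 hconj⟩
  · have hprod : Φ l.prod = Φ Y := (inv_mul_eq_one.1 (by simpa using hΦ)).symm
    obtain ⟨M, s, D, rfl, hM, hs⟩ := exists_step_leaving (S := {γ | a * Φ γ ∈ X}) (p := 1) (l := l)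
      (by simpa using ha) (by simpa [hprod] using hY.mul_notMem)
    have hM' : a * Φ M.prod ∈ X := by simpa using hM
    have hs' : a * Φ M.prod * Φ s ∉ X := by simpa [mul_assoc] using hs
    obtain ⟨rfl, hmul⟩ := eq_of_letter_leaving hY hK (hl s (by simp)) hM' hs'
    exact ⟨M, D, by simp, by simpa using hmul⟩

theorem prod_eq_one_of_map_prod_eq_one (ha : a ∈ X) (hY : LeavesOnlyAt (Φ Y) X a)
    (hK : ∀ s ∈ K, ∀ y, y * Φ s ∈ X ↔ y ∈ X) (hinj : ∀ s ∈ K, Φ s = 1 → s = 1) {l : List Γ}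
    (hl : ∀ s ∈ l, s = Y ∨ s = Y⁻¹ ∨ s ∈ K) (hΦ : Φ l.prod = 1) : l.prod = 1 := by
  induction hn : l.length using Nat.strong_induction_on generalizing l with
  | _ n ih =>
  by_cases hr : ∃ r ∈ l, r = Y ∨ r = Y⁻¹
  · obtain ⟨r, hrl, hr⟩ := hr
    obtain ⟨A, B, rfl⟩ := List.append_of_mem hrl
    have hrot : Φ (r * (B ++ A).prod) = 1 := by
      rw [List.prod_append, List.prod_cons, map_mul, mul_eq_one_comm, ← map_mul] at hΦ
      simpa [mul_assoc] using hΦ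
    have hBA : ∀ s ∈ B ++ A, s = Y ∨ s = Y⁻¹ ∨ s ∈ K := fun s hs =>
      hl s (by simp only [List.mem_append, List.mem_cons] at hs ⊢; tauto)
    obtain ⟨M, D, hMD, hM⟩ := exists_cancelling_letter ha hY hK hr hBA hrot
    have hlen := congrArg List.length hMD
    simp only [List.length_append, List.length_cons] at hlen hn
    rw [hMD] at hrot hBA
    have hM1 : M.prod = 1 := ih M.length (by omega) (fun s hs => hBA s (by simp [hs])) hM rfl
    have hD1 : D.prod = 1 := ih D.length (by omega) (fun s hs => hBA s (by simp [hs]))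
      (by simpa [hM] using hrot) rfl
    rw [List.prod_append, List.prod_cons, mul_eq_one_comm, mul_assoc, ← List.prod_append, hMD]
    simp [hM1, hD1]
  · push Not at hr
    refine hinj _ (K.list_prod_mem fun s hs => ?_) hΦ
    rcases hl s hs with h | h | h
    exacts [absurd h (hr s hs).1, absurd h (hr s hs).2, h]

theorem injective_of_leavesOnlyAt (ha : a ∈ X) (hY : LeavesOnlyAt (Φ Y) X a)
    (hK : ∀ s ∈ K, ∀ y, y * Φ s ∈ X ↔ y ∈ X) (hinj : ∀ s ∈ K, Φ s = 1 → s = 1)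
    (hgen : Subgroup.closure (insert Y (K : Set Γ)) = ⊤) : Function.Injective Φ := by
  refine (injective_iff_map_eq_one Φ).2 fun x hx => ?_
  have hx' : x ∈ (Subgroup.closure (insert Y (K : Set Γ))).toSubmonoid := by rw [hgen]; trivial
  rw [Subgroup.closure_toSubmonoid] at hx'
  obtain ⟨l, hl, rfl⟩ := Submonoid.exists_list_of_mem_closure hx'
  refine prod_eq_one_of_map_prod_eq_one ha hY hK hinj (fun s hs => ?_) hx
  have := hl s hs
  simp only [Set.mem_union, Set.mem_insert_iff, SetLike.mem_coe, Set.mem_inv, inv_mem_iff,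
    inv_eq_iff_eq_inv] at this
  tauto

end PingPong

section Presentation

variable {G : Type*} [Group G] {g h : G}

theorem range_eq_closure_pair {Γ : Type*} [Group Γ] (Φ : Γ →* G) (x : Fin 2 → Γ)
    (hx : Subgroup.closure (Set.range x) = ⊤) (h0 : Φ (x 0) = g) (h1 : Φ (x 1) = h) :
    Φ.range = Subgroup.closure {g, h} := by
  rw [MonoidHom.range_eq_map, ← hx, MonoidHom.map_closure, ← Set.range_comp]
  congr 1
  ext y
  simp [Fin.exists_fin_two, h0, h1, eq_comm]

theorem exists_mulEquiv_closure_pair {Γ : Type*} [Group Γ] (Φ : Γ →* G)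
    (hΦ : Function.Injective Φ) (x : Fin 2 → Γ)
    (hx : Subgroup.closure (Set.range x) = ⊤) (h0 : Φ (x 0) = g) (h1 : Φ (x 1) = h) :
    ∃ e : Γ ≃* Subgroup.closure ({g, h} : Set G), (e (x 0) : G) = g ∧ (e (x 1) : G) = h :=
  ⟨(MonoidHom.ofInjective hΦ).trans
    (MulEquiv.subgroupCongr (range_eq_closure_pair Φ x hx h0 h1)), h0, h1⟩

theorem pairIsFree_of_injective (hinj : Function.Injective (FreeGroup.lift ![g, h])) :
    PairIsFree g h :=
  exists_mulEquiv_closure_pair _ hinj FreeGroup.of (FreeGroup.closure_range_of _)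
    (by simp) (by simp)

theorem orderOf_mul_inv_eq_orderOf_inv_mul (g h : G) : orderOf (g * h⁻¹) = orderOf (h⁻¹ * g) :=
  SemiconjBy.orderOf_eq h⁻¹ (by simp [SemiconjBy, mul_assoc])

theorem mul_mul_inv_mem_iff_of_leavesOnlyAt_inv {X : Set G} {a : G} (hg : LeavesOnlyAt g⁻¹ X a)
    (hh : LeavesOnlyAt h⁻¹ X a) (y : G) : y * (g * h⁻¹) ∈ X ↔ y ∈ X := by
  rw [← mul_assoc, hh, ← hg, mul_inv_cancel_right]

theorem mul_mem_iff_of_mem_zpowers {t s : G} {X : Set G} (ht : ∀ y, y * t ∈ X ↔ y ∈ X)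
    (hs : s ∈ Subgroup.zpowers t) (y : G) : y * s ∈ X ↔ y ∈ X := by
  obtain ⟨i, rfl⟩ := hs
  induction i using Int.induction_on generalizing y with
  | zero => simp
  | succ i ih => simp only at ih ⊢; rw [zpow_add_one, ← mul_assoc, ht, ih]
  | pred i ih => simp only at ih ⊢; rw [← ht, zpow_sub_one, mul_assoc, inv_mul_cancel_right, ih]

theorem pairHasPresentation_of_leavesOnlyAt_inv {X : Set G} {a : G} (ha : a ∈ X)
    (hg : LeavesOnlyAt g⁻¹ X a) (hh : LeavesOnlyAt h⁻¹ X a) :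
    PairHasPresentation g h
      {((FreeGroup.of 1)⁻¹ * FreeGroup.of 0) ^ orderOf (h⁻¹ * g)} := by
  set rels : Set (FreeGroup (Fin 2)) :=
    {((FreeGroup.of 1)⁻¹ * FreeGroup.of 0) ^ orderOf (h⁻¹ * g)}
  have hr : ∀ r ∈ rels, FreeGroup.lift ![g, h] r = 1 := by
    rintro r rfl
    simp [pow_orderOf_eq_one]
  let Φ := PresentedGroup.toGroup hr
  let x : PresentedGroup rels := .of 0
  let y : PresentedGroup rels := .of 1
  have hx : Φ x = g := PresentedGroup.toGroup.of hr
  have hy : Φ y = h := PresentedGroup.toGroup.of hr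
  have hgen := PresentedGroup.closure_range_of rels
  have hpow : (x * y⁻¹) ^ orderOf (g * h⁻¹) = 1 := by
    have hrel : (y⁻¹ * x) ^ orderOf (h⁻¹ * g) = 1 := PresentedGroup.one_of_mem (rels := rels) rfl
    rw [orderOf_mul_inv_eq_orderOf_inv_mul, show x * y⁻¹ = y * (y⁻¹ * x) * y⁻¹ by group, conj_pow,
      hrel, mul_one, mul_inv_cancel]
  refine exists_mulEquiv_closure_pair Φ ?_ PresentedGroup.of hgen hx hy
  refine injective_of_leavesOnlyAt (K := Subgroup.zpowers (x * y⁻¹)) (Y := y⁻¹) ha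
    (by rwa [map_inv, hy]) ?_ ?_ ?_
  · rintro _ ⟨i, rfl⟩
    refine mul_mem_iff_of_mem_zpowers (mul_mul_inv_mem_iff_of_leavesOnlyAt_inv hg hh) ⟨i, ?_⟩
    simp [hx, hy]
  · rintro _ ⟨i, rfl⟩ hi
    obtain ⟨j, rfl⟩ : (orderOf (g * h⁻¹) : ℤ) ∣ i :=
      orderOf_dvd_iff_zpow_eq_one.2 (by simpa [hx, hy] using hi)
    simp [zpow_mul, hpow]
  · rw [← top_le_iff, ← hgen, Subgroup.closure_le]
    have hK : x * y⁻¹ ∈ Subgroup.closure (insert y⁻¹ (Subgroup.zpowers (x * y⁻¹) : Set _)) :=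
      Subgroup.subset_closure (Set.mem_insert_of_mem _ (Subgroup.mem_zpowers _))
    have hY : y ∈ Subgroup.closure (insert y⁻¹ (Subgroup.zpowers (x * y⁻¹) : Set _)) :=
      inv_mem_iff.1 (Subgroup.subset_closure (Set.mem_insert _ _))
    rintro _ ⟨i, rfl⟩
    fin_cases i
    · exact (mul_mem_cancel_right (inv_mem hY)).1 hK
    · exact hY

end Presentation

section Uncrossing

/-- The intersection of those left translates of the complement of `X` by elements of `K` that
contain `q`. It serves to uncross the translates of a cut `X` with two boundary edges, so as to
obtain a cut whose two boundary edges meet in `q`. -/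
def interCompl {G : Type*} [Group G] (K : Subgroup G) (X : Set G) (q : G) : Set G :=
  {y | ∀ s ∈ K, s * q ∉ X → s * y ∉ X}

variable {G : Type*} [Group G] {g h b : G} {X : Set G}

theorem self_mem_interCompl (K : Subgroup G) (X : Set G) (q : G) : q ∈ interCompl K X q :=
  fun _ _ hs => hs

theorem mem_zpowers_of_leavesOnlyAt (h1 : (1 : G) ∈ X) (hb : b ≠ 1) (hg : LeavesOnlyAt g X 1)
    (hh : LeavesOnlyAt h X b) (ht : IsOfFinOrder (g * h⁻¹)) :
    b ∈ Subgroup.zpowers (g * h⁻¹) := by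
  set t := g * h⁻¹
  have hth : t * h = g := inv_mul_cancel_right g h
  obtain ⟨m, hm, hm'⟩ : ∃ m : ℕ, t ^ m * g ∉ X ∧ t ^ (m + 1) * g ∈ X := by
    by_contra! hall
    have hnotMem : ∀ m : ℕ, t ^ m * g ∉ X := fun m => by
      induction m with
      | zero => simpa using hg.mul_notMem
      | succ m ih => exact hall m ih
    obtain ⟨m, hm : t ^ m = t⁻¹⟩ := ht.mem_powers_iff_mem_zpowers.2
      (inv_mem (Subgroup.mem_zpowers t))
    have hh1 : h ∈ X := by simpa using (hh 1).2 ⟨h1, hb.symm⟩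
    exact hnotMem m (by rwa [hm, ← hth, inv_mul_cancel_left])
  have hmem : t ^ (m + 1) ∈ X := hg.mem_of_mul_mem hm'
  have hnotMem : t ^ (m + 1) * h ∉ X := by rwa [pow_succ, mul_assoc, hth]
  exact hh.eq_of_mem_of_mul_notMem hmem hnotMem ▸ pow_mem (Subgroup.mem_zpowers t) _

theorem eq_one_of_mul_mem_interCompl (h1 : (1 : G) ∈ X) (hb : b ≠ 1) (hg : LeavesOnlyAt g X 1)
    (hh : LeavesOnlyAt h X b) (ht : IsOfFinOrder (g * h⁻¹)) {s : G}
    (hs : s ∈ Subgroup.zpowers (g * h⁻¹))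
    (hsg : s * g ∈ interCompl (Subgroup.zpowers (g * h⁻¹)) X g) : s = 1 := by
  set t := g * h⁻¹
  have hth : t⁻¹ * g = h := by simp [t]
  have hh1 : h ∈ X := by simpa using (hh 1).2 ⟨h1, hb.symm⟩
  have hsg1 : s * g ∉ X := by simpa using hsg 1 (one_mem _) (by simpa using hg.mul_notMem)
  have hcomm : t⁻¹ * s = s * t⁻¹ := by
    obtain ⟨i, rfl⟩ := hs
    exact ((Commute.refl t).inv_left.zpow_right i).eq
  by_cases hsh : s * h ∈ X
  · exact hg.eq_of_mem_of_mul_notMem (hh.mem_of_mul_mem hsh) hsg1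
  have hpow : ∀ m : ℕ, t⁻¹ * s ^ (m + 1) * g ∉ X := fun m => by
    induction m with
    | zero => rwa [zero_add, pow_one, hcomm, mul_assoc, hth]
    | succ m ih =>
      rw [pow_succ, ← mul_assoc, mul_assoc _ s g]
      exact hsg _ (mul_mem (inv_mem (Subgroup.mem_zpowers t)) (pow_mem hs _)) ih
  obtain ⟨m, hm : s ^ m = s⁻¹⟩ := (ht.of_mem_zpowers hs).mem_powers_iff_mem_zpowers.2
    (inv_mem (Subgroup.mem_zpowers s))
  exact absurd hh1 (by simpa [pow_succ, hm, hth] using hpow m)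

theorem leavesOnlyAt_inv_interCompl (h1 : (1 : G) ∈ X) (hb : b ≠ 1) (hg : LeavesOnlyAt g X 1)
    (hh : LeavesOnlyAt h X b) (ht : IsOfFinOrder (g * h⁻¹)) {u d : G} (hd : d ∈ X)
    (hu : LeavesOnlyAt u X d) (hdu : d * u * g⁻¹ ∈ Subgroup.zpowers (g * h⁻¹)) :
    LeavesOnlyAt u⁻¹ (interCompl (Subgroup.zpowers (g * h⁻¹)) X g) g := by
  refine fun y => ⟨fun hy => ⟨fun s hs hsg hsy => ?_, ?_⟩, fun ⟨hy, hyg⟩ s hs hsg hsy => ?_⟩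
  · refine hy s hs hsg (hu.mem_of_mul_mem ?_)
    simpa [mul_assoc] using hsy
  · rintro rfl
    refine hy _ hdu ?_ ?_
    · simpa using hu.mul_notMem
    · simpa [mul_assoc] using hd
  · have hsyd : s * (y * u⁻¹) = d :=
      hu.eq_of_mem_of_mul_notMem hsy (by simpa [mul_assoc] using hy s hs hsg)
    have hy_eq : y = s⁻¹ * (d * u * g⁻¹) * g := by simp [← hsyd, mul_assoc]
    have hone := eq_one_of_mul_mem_interCompl h1 hb hg hh ht (mul_mem (inv_mem hs) hdu)
      (hy_eq ▸ hy)
    exact hyg (by rw [hy_eq, hone, one_mul])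

theorem exists_leavesOnlyAt_inv (h1 : (1 : G) ∈ X) (hbX : b ∈ X) (hb : b ≠ 1)
    (hg : LeavesOnlyAt g X 1) (hh : LeavesOnlyAt h X b) (ht : IsOfFinOrder (g * h⁻¹)) :
    ∃ W : Set G, ∃ q ∈ W, LeavesOnlyAt g⁻¹ W q ∧ LeavesOnlyAt h⁻¹ W q := by
  refine ⟨_, g, self_mem_interCompl (Subgroup.zpowers (g * h⁻¹)) X g,
    leavesOnlyAt_inv_interCompl h1 hb hg hh ht h1 hg (by simp),
    leavesOnlyAt_inv_interCompl h1 hb hg hh ht hbX hh ?_⟩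
  have hmem := mul_mem (mem_zpowers_of_leavesOnlyAt h1 hb hg hh ht)
    (inv_mem (Subgroup.mem_zpowers (g * h⁻¹)))
  simpa [mul_assoc] using hmem

end Uncrossing

section ReducedWords

theorem of_ne_inv_of {α : Type*} (x y : α) : FreeGroup.of x ≠ (FreeGroup.of y)⁻¹ := fun h => by
  classical simpa [FreeGroup.toWord_inv, FreeGroup.invRev] using congrArg FreeGroup.toWord h

variable {α : Type*} [DecidableEq α]

theorem toWord_mul_eq_append {u v : FreeGroup α} (h : (u * v).norm = u.norm + v.norm) :
    (u * v).toWord = u.toWord ++ v.toWord :=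
  (FreeGroup.toWord_mul_sublist u v).eq_of_length (by rw [List.length_append]; exact h)

theorem eq_and_eq_of_mul_eq_mul {u v u' v' : FreeGroup α} (heq : u * v = u' * v')
    (huv : (u * v).norm = u.norm + v.norm) (huv' : (u' * v').norm = u'.norm + v'.norm)
    (hu : u.norm = u'.norm) : u = u' ∧ v = v' := by
  have happend : u.toWord ++ v.toWord = u'.toWord ++ v'.toWord := by
    rw [← toWord_mul_eq_append huv, ← toWord_mul_eq_append huv', heq]
  obtain ⟨hword, hword'⟩ := List.append_inj happend hu
  exact ⟨FreeGroup.toWord_injective hword, FreeGroup.toWord_injective hword'⟩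

theorem exists_eq_of_or_eq_inv_of {u : FreeGroup α} (hu : u.norm = 1) :
    ∃ x, u = FreeGroup.of x ∨ u = (FreeGroup.of x)⁻¹ := by
  obtain ⟨⟨x, b⟩, hx⟩ := List.length_eq_one_iff.1 hu
  refine ⟨x, ?_⟩
  rw [← FreeGroup.mk_toWord (x := u), hx]
  cases b
  · exact Or.inr rfl
  · exact Or.inl rfl

end ReducedWords

section ShortestLoops

/-- The `i`-th step of the walk `c`. Walks are two-sided infinite and run in the Cayley tree of a
free group. -/
def step {Γ : Type*} [Group Γ] (c : ℤ → Γ) (i : ℤ) : Γ :=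
  (c i)⁻¹ * c (i + 1)

/-- The walk `c` in the Cayley tree of the free group on `α` covers a closed walk of length `n` in
the Cayley graph of the pair `(G, f)`, traversed periodically, and no nontrivial relation of `f` is
shorter than `n`. Working in the tree, at arbitrary integer times, makes the choice of a base point
and of an orientation of the closed walk immaterial. -/
structure IsShortestLoop {α G : Type*} [DecidableEq α] [Group G] (f : α → G) (n : ℕ)
    (c : ℤ → FreeGroup α) : Prop where
  norm_step_le_one : ∀ i, (step c i).norm ≤ 1
  lift_add : ∀ i, FreeGroup.lift f (c (i + n)) = FreeGroup.lift f (c i)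
  add_ne : ∀ i, c (i + n) ≠ c i
  le_norm : ∀ w, w ≠ 1 → FreeGroup.lift f w = 1 → n ≤ w.norm

theorem mul_step {Γ : Type*} [Group Γ] (c : ℤ → Γ) (i : ℤ) : c i * step c i = c (i + 1) :=
  mul_inv_cancel_left _ _

theorem step_neg {Γ : Type*} [Group Γ] (c : ℤ → Γ) (i : ℤ) :
    step (fun k => c (-k)) i = (step c (-i - 1))⁻¹ := by
  simp [step, sub_eq_neg_add]

variable {α G : Type*} [DecidableEq α] [Group G] {f : α → G} {n : ℕ} {c c' : ℤ → FreeGroup α}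
  {i j i' j' : ℤ} {w : FreeGroup α}

/-- The walk along the periodic word `⋯www⋯` that is at `1` at time `0`. For a relation `w` of
minimal length it is a shortest loop. -/
def periodicWalk (w : FreeGroup α) (i : ℤ) : FreeGroup α :=
  w ^ (i / w.norm) * FreeGroup.mk (w.toWord.take (i % w.norm).toNat)

theorem periodicWalk_mul_add (hw : w ≠ 1) (q : ℤ) {r : ℕ} (hr : r ≤ w.norm) :
    periodicWalk w (w.norm * q + r) = w ^ q * FreeGroup.mk (w.toWord.take r) := by
  have hpos : (0 : ℤ) < w.norm := by
    have := FreeGroup.norm_eq_zero.not.2 hw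
    omega
  rcases hr.lt_or_eq with hr | rfl
  · obtain ⟨hdiv, hmod⟩ := (Int.ediv_emod_unique (a := w.norm * q + r) (r := r) (q := q) hpos).2
      ⟨add_comm _ _, by omega, by omega⟩
    rw [periodicWalk, hdiv, hmod, Int.toNat_natCast]
  · have hmk : FreeGroup.mk (w.toWord.take w.norm) = w := by
      rw [FreeGroup.norm, List.take_length, FreeGroup.mk_toWord]
    rw [← mul_add_one, periodicWalk, Int.mul_ediv_cancel_left _ hpos.ne', Int.mul_emod_right, hmk,
      zpow_add_one]
    exact mul_one _

theorem exists_eq_norm_mul_add (hw : w ≠ 1) (i : ℤ) :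
    ∃ q : ℤ, ∃ r : ℕ, r < w.norm ∧ i = w.norm * q + r := by
  have hpos : (w.norm : ℤ) ≠ 0 := by exact_mod_cast FreeGroup.norm_eq_zero.not.2 hw
  have := Int.emod_nonneg i hpos
  have := Int.emod_lt_of_pos i (b := w.norm) (by omega)
  have := Int.mul_ediv_add_emod i w.norm
  exact ⟨i / w.norm, (i % w.norm).toNat, by omega, by omega⟩

theorem periodicWalk_add (hw : w ≠ 1) (i : ℤ) :
    periodicWalk w (i + w.norm) = w * periodicWalk w i := by
  obtain ⟨q, r, hr, rfl⟩ := exists_eq_norm_mul_add hw i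
  rw [show (w.norm : ℤ) * q + r + w.norm = w.norm * (1 + q) + r by ring,
    periodicWalk_mul_add hw _ hr.le, periodicWalk_mul_add hw _ hr.le, zpow_one_add, mul_assoc]

theorem norm_step_periodicWalk_le_one (hw : w ≠ 1) (i : ℤ) :
    (step (periodicWalk w) i).norm ≤ 1 := by
  obtain ⟨q, r, hr, rfl⟩ := exists_eq_norm_mul_add hw i
  have hstep : step (periodicWalk w) (w.norm * q + r) = FreeGroup.mk [w.toWord[r]'hr] := by
    rw [step, inv_mul_eq_iff_eq_mul, add_assoc, ← Nat.cast_add_one, periodicWalk_mul_add hw _ hr,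
      periodicWalk_mul_add hw _ hr.le, mul_assoc, FreeGroup.mul_mk,
      List.take_append_getElem (l := w.toWord) hr]
  exact hstep ▸ FreeGroup.norm_mk_le

theorem exists_isShortestLoop (hf : ¬ Function.Injective (FreeGroup.lift f)) :
    ∃ n c, IsShortestLoop f n c := by
  have hker : ∃ w, w ≠ 1 ∧ FreeGroup.lift f w = 1 := by
    rw [injective_iff_map_eq_one] at hf
    push Not at hf
    simpa only [and_comm] using hf
  obtain ⟨w, ⟨hne, hw⟩, hmin⟩ := exists_minimalFor_of_wellFoundedLT _ FreeGroup.norm hker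
  exact ⟨w.norm, periodicWalk w,
    { norm_step_le_one := norm_step_periodicWalk_le_one hne
      lift_add := fun i => by rw [periodicWalk_add hne, map_mul, hw, one_mul]
      add_ne := fun i => by rwa [periodicWalk_add hne, Ne, mul_eq_right]
      le_norm := fun v hv hv1 => (le_total _ _).elim id (hmin ⟨hv, hv1⟩) }⟩

namespace IsShortestLoop

theorem reverse (hc : IsShortestLoop f n c) : IsShortestLoop f n fun k => c (-k) where
  norm_step_le_one i := by
    rw [step_neg, FreeGroup.norm_inv_eq]
    exact hc.norm_step_le_one _
  lift_add i := by simpa using (hc.lift_add (-(i + n))).symm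
  add_ne i := by simpa using (hc.add_ne (-(i + n))).symm
  le_norm := hc.le_norm

theorem eq_of_lift_eq (hc : IsShortestLoop f n c) {u v : FreeGroup α}
    (huv : FreeGroup.lift f u = FreeGroup.lift f v) (hn : u.norm + v.norm < n) : u = v := by
  by_contra hne
  have hle := hc.le_norm (u⁻¹ * v) (by simpa [inv_mul_eq_one] using hne) (by simp [huv])
  have hmul := FreeGroup.norm_mul_le u⁻¹ v
  rw [FreeGroup.norm_inv_eq] at hmul
  omega

theorem norm_arc_le (hc : IsShortestLoop f n c) (hij : i ≤ j) :
    (((c i)⁻¹ * c j).norm : ℤ) ≤ j - i := by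
  induction j, hij using Int.leInduction with
  | base => simp
  | succ j _ ih =>
    have hmul := FreeGroup.norm_mul_le ((c i)⁻¹ * c j) (step c j)
    rw [mul_assoc, mul_step] at hmul
    have := hc.norm_step_le_one j
    omega

theorem norm_arc (hc : IsShortestLoop f n c) (hij : i ≤ j) (hj : j ≤ i + n) :
    (((c i)⁻¹ * c j).norm : ℤ) = j - i := by
  have hle := hc.le_norm ((c i)⁻¹ * c (i + n))
    (by simpa [inv_mul_eq_one, eq_comm] using hc.add_ne i) (by simp [hc.lift_add])
  have hmul := FreeGroup.norm_mul_le ((c i)⁻¹ * c j) ((c j)⁻¹ * c (i + n))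
  rw [mul_assoc, mul_inv_cancel_left] at hmul
  have := hc.norm_arc_le hij
  have := hc.norm_arc_le hj
  omega

theorem one_le (hc : IsShortestLoop f n c) : 1 ≤ n := by
  by_contra! hn
  exact hc.add_ne 0 (by simp [Nat.lt_one_iff.1 hn])

theorem norm_step (hc : IsShortestLoop f n c) (i : ℤ) : (step c i).norm = 1 := by
  have hn := hc.one_le
  have := hc.norm_arc (i := i) (j := i + 1) (by omega) (by omega)
  simp only [step]
  omega

theorem exists_step_eq (hc : IsShortestLoop f n c) (i : ℤ) :
    ∃ x, step c i = FreeGroup.of x ∨ step c i = (FreeGroup.of x)⁻¹ :=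
  exists_eq_of_or_eq_inv_of (hc.norm_step i)

theorem step_add_one_ne (hc : IsShortestLoop f n c) (hn : 2 ≤ n) (i : ℤ) :
    step c (i + 1) ≠ (step c i)⁻¹ := fun h => by
  have hnorm := hc.norm_arc (i := i) (j := i + 1 + 1) (by omega) (by omega)
  rw [← mul_step c, ← mul_step c, h, mul_inv_cancel_right, inv_mul_cancel,
    FreeGroup.norm_one] at hnorm
  omega

theorem step_add_ne_inv (hc : IsShortestLoop f n c) (hn : 2 ≤ n) {e : ℤ} (he : e = 1 ∨ e = -1)
    (i : ℤ) : step c (i + e) ≠ (step c i)⁻¹ := fun h => by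
  rcases he with rfl | rfl
  · exact hc.step_add_one_ne hn i h
  · exact hc.step_add_one_ne hn (i + -1) (by rw [neg_add_cancel_right, h, inv_inv])

theorem arc_eq_arc (hc : IsShortestLoop f n c) (hc' : IsShortestLoop f n c') (hij : i ≤ j)
    (hij' : i' ≤ j') (hlen : j - i + (j' - i') < n)
    (hlift : FreeGroup.lift f ((c i)⁻¹ * c j) = FreeGroup.lift f ((c' i')⁻¹ * c' j')) :
    (c i)⁻¹ * c j = (c' i')⁻¹ * c' j' := by
  have := hc.norm_arc_le hij
  have := hc'.norm_arc_le hij'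
  exact hc.eq_of_lift_eq hlift (by omega)

theorem sub_eq_sub_of_lift_mul_eq_one (hc : IsShortestLoop f n c) (hc' : IsShortestLoop f n c')
    (hij : i ≤ j) (hij' : i' ≤ j') (hlen : j - i + (j' - i') < n)
    (hlift : FreeGroup.lift f ((c i)⁻¹ * c j) * FreeGroup.lift f ((c' i')⁻¹ * c' j') = 1) :
    j - i = j' - i' := by
  have hnorm := hc.norm_arc hij (by omega)
  have hnorm' := hc'.norm_arc hij' (by omega)
  have heq := hc.eq_of_lift_eq (u := (c i)⁻¹ * c j) (v := ((c' i')⁻¹ * c' j')⁻¹)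
    (by rw [map_inv]; exact eq_inv_of_mul_eq_one_left hlift)
    (by rw [FreeGroup.norm_inv_eq]; omega)
  rw [heq, FreeGroup.norm_inv_eq] at hnorm
  exact hnorm.symm.trans hnorm'

theorem step_eq_of_arc_eq (hc : IsShortestLoop f n c) (hc' : IsShortestLoop f n c')
    (hij : i < j) (hj : j ≤ i + n) (hij' : i' < j') (hj' : j' ≤ i' + n)
    (heq : (c i)⁻¹ * c j = (c' i')⁻¹ * c' j') : step c i = step c' i' := by
  have hsplit : ∀ (d : ℤ → FreeGroup α) (k l : ℤ), (d k)⁻¹ * d l =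
      step d k * ((d (k + 1))⁻¹ * d l) := fun d k l => by simp [step, mul_assoc]
  have hnorm : ∀ {d : ℤ → FreeGroup α}, IsShortestLoop f n d → ∀ {k l : ℤ}, k < l → l ≤ k + n →
      (step d k * ((d (k + 1))⁻¹ * d l)).norm =
        (step d k).norm + ((d (k + 1))⁻¹ * d l).norm := fun hd k l hkl hl => by
    have := hd.norm_arc hkl.le hl
    have := hd.norm_arc (i := k + 1) (j := l) hkl (by omega)
    rw [← hsplit, hd.norm_step]
    omega
  rw [hsplit, hsplit c'] at heq
  exact (eq_and_eq_of_mul_eq_mul heq (hnorm hc hij hj) (hnorm hc' hij' hj')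
    (by rw [hc.norm_step, hc'.norm_step])).1

theorem step_sub_one_eq_of_arc_eq (hc : IsShortestLoop f n c) (hc' : IsShortestLoop f n c')
    (hij : i < j) (hj : j ≤ i + n) (hij' : i' < j') (hj' : j' ≤ i' + n)
    (heq : (c i)⁻¹ * c j = (c' i')⁻¹ * c' j') : step c (j - 1) = step c' (j' - 1) := by
  have hrev := hc.reverse.step_eq_of_arc_eq hc'.reverse (i := -j) (j := -i) (i' := -j')
    (j' := -i') (by omega) (by omega) (by omega) (by omega)
    (by simpa using congrArg (·⁻¹) heq)
  simpa [step_neg] using hrev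

end IsShortestLoop

end ShortestLoops

section PartnerArcs

/-- The boundary of `X` in the Cayley graph of the pair `(G, f)` consists of the two edges
`a x → a x * f x`, both outgoing. The letters are `0` and `1`, so that `1 - x` is the letter other
than `x`; the cuts of interest come from wS-subsets. -/
structure IsTwoEdgeCut {G : Type*} [Group G] (f a : Fin 2 → G) (X : Set G) : Prop where
  mem : ∀ x, a x ∈ X
  leavesOnlyAt : ∀ x, LeavesOnlyAt (f x) X (a x)
  ne : ∀ x, a x ≠ a (1 - x)

/-- The arc of `c` from time `i` to time `i + L` begins with the letter `x`, ends with the inverse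
of the other letter, and represents `(a x)⁻¹ * a (1 - x)`. Thus the translate of `c` with `c i`
moved to `a x` leaves a two-edge cut through one of the boundary edges at time `i` and comes back
through the other one at time `i + L`. -/
structure IsPartnerArc {G : Type*} [Group G] (f a : Fin 2 → G) (n : ℕ) (c : ℤ → FreeGroup (Fin 2))
    (i L : ℤ) (x : Fin 2) : Prop where
  two_le : 2 ≤ L
  lt : L < n
  step_first : step c i = FreeGroup.of x
  step_last : step c (i + L - 1) = (FreeGroup.of (1 - x))⁻¹
  lift_arc : FreeGroup.lift f ((c i)⁻¹ * c (i + L)) = (a x)⁻¹ * a (1 - x)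

theorem eq_one_sub_of_ne {x z : Fin 2} (h : z ≠ x) : z = 1 - x := by
  omega

variable {G : Type*} [Group G] {f a : Fin 2 → G} {X : Set G} {n : ℕ}
  {c c' : ℤ → FreeGroup (Fin 2)} {i i' L L' : ℤ} {x x' : Fin 2}

theorem exists_return_step (hX : IsTwoEdgeCut f a X) (hc : IsShortestLoop f n c)
    (hi : step c i = FreeGroup.of x) :
    ∃ k : ℤ, ∃ z, 1 ≤ k ∧ k < n ∧ step c (i + k) = (FreeGroup.of z)⁻¹ ∧
      a x * FreeGroup.lift f ((c i)⁻¹ * c (i + k + 1)) = a z := by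
  obtain ⟨k, hk, hkn, hout, hin⟩ : ∃ k : ℤ, 1 ≤ k ∧ k < n ∧
      a x * FreeGroup.lift f ((c i)⁻¹ * c (i + k)) ∉ X ∧
      a x * FreeGroup.lift f ((c i)⁻¹ * c (i + k + 1)) ∈ X := by
    by_contra! hall
    have hout : ∀ k : ℤ, 1 ≤ k → k ≤ n → a x * FreeGroup.lift f ((c i)⁻¹ * c (i + k)) ∉ X :=
        fun k hk => by
      induction k, hk using Int.leInduction with
      | base =>
        intro _
        rw [← step, hi, FreeGroup.lift_apply_of]
        exact (hX.leavesOnlyAt x).mul_notMem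
      | succ k hk ih =>
        intro hkn
        rw [← add_assoc]
        exact hall k hk (by omega) (ih (by omega))
    exact hout n (by exact_mod_cast hc.one_le) le_rfl (by simpa [hc.lift_add] using hX.mem x)
  rw [← mul_step c, ← mul_assoc, map_mul, ← mul_assoc] at hin
  obtain ⟨z, hz | hz⟩ := hc.exists_step_eq (i + k)
  · rw [hz, FreeGroup.lift_apply_of] at hin
    exact absurd ((hX.leavesOnlyAt z).mem_of_mul_mem hin) hout
  · refine ⟨k, z, hk, hkn, hz, ?_⟩
    rw [hz, map_inv, FreeGroup.lift_apply_of] at hin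
    rw [← mul_step c, ← mul_assoc, map_mul, ← mul_assoc, hz, map_inv, FreeGroup.lift_apply_of]
    exact (hX.leavesOnlyAt z).eq_of_mem_of_mul_notMem hin (by rwa [inv_mul_cancel_right])

theorem exists_isPartnerArc (hX : IsTwoEdgeCut f a X) (hc : IsShortestLoop f n c)
    (hi : step c i = FreeGroup.of x) : ∃ L, IsPartnerArc f a n c i L x := by
  obtain ⟨k, z, hk, hkn, hstep, harc⟩ := exists_return_step hX hc hi
  have hzx : z ≠ x := by
    rintro rfl
    have hloop : FreeGroup.lift f (c i) = FreeGroup.lift f (c (i + k + 1)) := by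
      simpa [inv_mul_eq_one] using harc
    have hinner : (c (i + 1))⁻¹ * c (i + k) = 1 := by
      refine hc.eq_of_lift_eq ?_ ?_
      · rw [← mul_step c i, hi, eq_mul_inv_of_mul_eq (mul_step c (i + k)), hstep]
        simp [hloop]
      · have := hc.norm_arc_le (i := i + 1) (j := i + k) (by omega)
        rw [FreeGroup.norm_one]
        omega
    have hk1 := hc.norm_arc (i := i + 1) (j := i + k) (by omega) (by omega)
    rw [hinner, FreeGroup.norm_one] at hk1
    obtain rfl : k = 1 := by omega
    exact hc.step_add_one_ne (by omega) i (by rw [hstep, hi])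
  obtain rfl := eq_one_sub_of_ne hzx
  have hk_ne : k + 1 ≠ n := fun hkn' => by
    rw [add_assoc, hkn', map_mul, map_inv, hc.lift_add, inv_mul_cancel, mul_one] at harc
    exact hX.ne x harc
  refine ⟨k + 1, by omega, by omega, hi, ?_, ?_⟩
  · rwa [show i + (k + 1) - 1 = i + k by ring]
  · rw [eq_inv_mul_iff_mul_eq, ← add_assoc, harc]

namespace IsPartnerArc

theorem reverse (h : IsPartnerArc f a n c i L x) :
    IsPartnerArc f a n (fun k => c (-k)) (-(i + L)) L (1 - x) where
  two_le := h.two_le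
  lt := h.lt
  step_first := by rw [step_neg, neg_neg, h.step_last, inv_inv]
  step_last := by
    rw [step_neg, show -(-(i + L) + L - 1) - 1 = i by ring, h.step_first, sub_sub_cancel]
  lift_arc := by
    simpa using congrArg (·⁻¹) h.lift_arc

theorem lift_tail (h : IsPartnerArc f a n c i L x) :
    FreeGroup.lift f ((c (i + 1))⁻¹ * c (i + L)) = (f x)⁻¹ * ((a x)⁻¹ * a (1 - x)) := by
  rw [← mul_step c i, h.step_first, ← h.lift_arc]
  simp [mul_assoc]

theorem lift_inner (h : IsPartnerArc f a n c i L x) :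
    FreeGroup.lift f ((c (i + 1))⁻¹ * c (i + L - 1)) =
      (f x)⁻¹ * ((a x)⁻¹ * a (1 - x)) * f (1 - x) := by
  have hlast := mul_step c (i + L - 1)
  rw [h.step_last, sub_add_cancel] at hlast
  rw [← h.lift_tail, ← hlast]
  simp [mul_assoc]

theorem length_le (hc : IsShortestLoop f n c) (hc' : IsShortestLoop f n c')
    (h : IsPartnerArc f a n c i L x) (h' : IsPartnerArc f a n c' i' L' x) : L' ≤ L := by
  by_contra! hlt
  have hL := h.two_le
  have hL' := h'.lt
  have houter := hc.sub_eq_sub_of_lift_mul_eq_one hc' (i := i) (j := i + L) (i' := i' + L')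
    (j' := i' + n) (by omega) (by omega) (by omega) (by
      rw [h.lift_arc, ← h'.lift_arc]
      simp [hc'.lift_add])
  have hinner := hc.sub_eq_sub_of_lift_mul_eq_one hc' (i := i + 1) (j := i + L) (i' := i' + L')
    (j' := i' + 1 + n) (by omega) (by omega) (by omega) (by
      rw [h.lift_tail, ← h'.lift_tail]
      simp [hc'.lift_add])
  omega

theorem length_eq (hc : IsShortestLoop f n c) (hc' : IsShortestLoop f n c')
    (h : IsPartnerArc f a n c i L x) (h' : IsPartnerArc f a n c' i' L' x') : L' = L := by
  by_cases hx : x' = x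
  · subst hx
    exact le_antisymm (length_le hc hc' h h') (length_le hc' hc h' h)
  · obtain rfl := eq_one_sub_of_ne hx
    exact le_antisymm (length_le hc.reverse hc' h.reverse h')
      (length_le hc' hc.reverse h' h.reverse)

theorem step_add_one_eq (hc : IsShortestLoop f n c) (hc' : IsShortestLoop f n c')
    (h : IsPartnerArc f a n c i L x) (h' : IsPartnerArc f a n c' i' L x) (hL : 2 * L ≤ n) :
    step c (i + 1) = step c' (i' + 1) := by
  rcases h.two_le.eq_or_lt with rfl | hL2
  · simpa only [add_sub_assoc, show (2 : ℤ) - 1 = 1 by rfl] using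
      h.step_last.trans h'.step_last.symm
  · exact hc.step_eq_of_arc_eq hc' (by omega) (by omega) (by omega) (by omega)
      (hc.arc_eq_arc hc' (by omega) (by omega) (by omega) (h.lift_inner.trans h'.lift_inner.symm))

theorem step_sub_one_eq (hc : IsShortestLoop f n c) (hc' : IsShortestLoop f n c')
    (h : IsPartnerArc f a n c i L x) (h' : IsPartnerArc f a n c' i' L x) (hL : n < 2 * L) :
    step c (i - 1) = step c' (i' - 1) := by
  have hLn := h.lt
  refine hc.step_sub_one_eq_of_arc_eq hc' (i := i + L - n) (i' := i' + L - n) (by omega)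
    (by omega) (by omega) (by omega) (hc.arc_eq_arc hc' (by omega) (by omega) (by omega) ?_)
  have harc := h.lift_arc.trans h'.lift_arc.symm
  have hshift : ∀ {d : ℤ → FreeGroup (Fin 2)}, IsShortestLoop f n d → ∀ k,
      FreeGroup.lift f (d (k - n)) = FreeGroup.lift f (d k) := fun hd k => by
    rw [← hd.lift_add, sub_add_cancel]
  simpa [hshift hc, hshift hc'] using congrArg (·⁻¹) harc

end IsPartnerArc

end PartnerArcs

section Alternation

variable {G : Type*} [Group G] {f a : Fin 2 → G} {X : Set G} {n : ℕ}
  {c c' : ℤ → FreeGroup (Fin 2)} {i : ℤ} {x : Fin 2}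

/-- Partner arcs with the same first letter spell the same word if they make up at most half of the
loop; otherwise their complements do. -/
theorem exists_direction_step_eq (hX : IsTwoEdgeCut f a X) :
    ∃ e : ℤ, (e = 1 ∨ e = -1) ∧ ∀ {c c'}, IsShortestLoop f n c → IsShortestLoop f n c' →
      ∀ {i i' x}, step c i = FreeGroup.of x → step c' i' = FreeGroup.of x →
        step c (i + e) = step c' (i' + e) := by
  by_cases hshort : ∃ c i L x, IsShortestLoop f n c ∧ IsPartnerArc f a n c i L x ∧ 2 * L ≤ n
  · obtain ⟨c₀, i₀, L₀, x₀, hc₀, h₀, hL₀⟩ := hshort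
    refine ⟨1, Or.inl rfl, fun {c c'} hc hc' {i i' x} hi hi' => ?_⟩
    obtain ⟨L, h⟩ := exists_isPartnerArc hX hc hi
    obtain ⟨L', h'⟩ := exists_isPartnerArc hX hc' hi'
    obtain rfl := h₀.length_eq hc₀ hc h
    obtain rfl := h.length_eq hc hc' h'
    exact h.step_add_one_eq hc hc' h' hL₀
  · push Not at hshort
    refine ⟨-1, Or.inr rfl, fun {c c'} hc hc' {i i' x} hi hi' => ?_⟩
    obtain ⟨L, h⟩ := exists_isPartnerArc hX hc hi
    obtain ⟨L', h'⟩ := exists_isPartnerArc hX hc' hi'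
    obtain rfl := h.length_eq hc hc' h'
    exact h.step_sub_one_eq hc hc' h' (hshort c i _ x hc h)

theorem two_lt_of_step_eq_of (hX : IsTwoEdgeCut f a X) (hc : IsShortestLoop f n c)
    (hi : step c i = FreeGroup.of x) : 2 < n := by
  obtain ⟨L, h⟩ := exists_isPartnerArc hX hc hi
  have := h.two_le
  have := h.lt
  omega

theorem exists_step_add_eq_inv_of (hX : IsTwoEdgeCut f a X) (hc : IsShortestLoop f n c) {e : ℤ}
    (he : e = 1 ∨ e = -1) (hi : step c i = FreeGroup.of x) :
    ∃ j y, step c j = FreeGroup.of y ∧ step c (j + e) = (FreeGroup.of (1 - y))⁻¹ := by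
  by_contra! hall
  have hpos : ∀ k : ℕ, ∃ y, step c (i + k * e) = FreeGroup.of y := fun k => by
    induction k with
    | zero => exact ⟨x, by simpa using hi⟩
    | succ k ih =>
      obtain ⟨y, hy⟩ := ih
      rw [Nat.cast_add_one, add_one_mul, ← add_assoc]
      obtain ⟨z, hz | hz⟩ := hc.exists_step_eq (i + k * e + e)
      · exact ⟨z, hz⟩
      · have hzy : z ≠ y := by
          rintro rfl
          exact hc.step_add_ne_inv (two_lt_of_step_eq_of hX hc hi).le he _ (hz.trans (hy ▸ rfl))
        exact absurd (eq_one_sub_of_ne hzy ▸ hz) (hall _ y hy)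
  have hlast : ∀ {j L y}, IsPartnerArc f a n c j L y → ∀ k : ℕ, i + k * e ≠ j + L - 1 :=
      fun harc k hk => by
    obtain ⟨y, hy⟩ := hpos k
    exact of_ne_inv_of _ _ (hy.symm.trans (hk ▸ harc.step_last))
  rcases he with rfl | rfl
  · obtain ⟨L, harc⟩ := exists_isPartnerArc hX hc hi
    have := harc.two_le
    exact hlast harc (L - 1).toNat (by omega)
  · obtain ⟨y, hy⟩ := hpos n
    obtain ⟨L, harc⟩ := exists_isPartnerArc hX hc hy
    have := harc.lt
    exact hlast harc (n + 1 - L).toNat (by omega)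

theorem exists_direction_step_eq_inv_of (hX : IsTwoEdgeCut f a X) :
    ∃ e : ℤ, (e = 1 ∨ e = -1) ∧ ∀ {c}, IsShortestLoop f n c →
      ∀ {i x}, step c i = FreeGroup.of x → step c (i + e) = (FreeGroup.of (1 - x))⁻¹ := by
  obtain ⟨e, he, heq⟩ := exists_direction_step_eq (n := n) hX
  refine ⟨e, he, fun {c} hc {i x} hi => ?_⟩
  obtain ⟨j, y, hj, hje⟩ := exists_step_add_eq_inv_of hX hc he hi
  by_cases hxy : x = y
  · subst hxy
    exact (heq hc hc hi hj).trans hje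
  · obtain rfl := eq_one_sub_of_ne hxy
    have hrev : step (fun k => c (-k)) (-(j + e) - 1) = FreeGroup.of (1 - y) := by
      rw [step_neg, show -(-(j + e) - 1) - 1 = j + e by ring, hje, inv_inv]
    rw [heq hc hc.reverse hi hrev, step_neg, show -(-(j + e) - 1 + e) - 1 = j by ring, hj,
      sub_sub_cancel]

theorem step_add_one_eq_inv_of (hX : IsTwoEdgeCut f a X) (hc : IsShortestLoop f n c)
    (hi : step c i = FreeGroup.of x) : step c (i + 1) = (FreeGroup.of (1 - x))⁻¹ := by
  obtain ⟨e, rfl | rfl, heq⟩ := exists_direction_step_eq_inv_of (n := n) hX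
  · exact heq hc hi
  · obtain ⟨z, hz | hz⟩ := hc.exists_step_eq (i + 1)
    · have hiz := heq hc hz
      rw [add_neg_cancel_right, hi] at hiz
      exact absurd hiz (of_ne_inv_of _ _)
    · have hzx : z ≠ x := by
        rintro rfl
        exact hc.step_add_one_ne (two_lt_of_step_eq_of hX hc hi).le i (by rw [hz, hi])
      exact eq_one_sub_of_ne hzx ▸ hz

theorem step_add_two_eq_of (hX : IsTwoEdgeCut f a X) (hc : IsShortestLoop f n c)
    (hi : step c i = FreeGroup.of x) : step c (i + 1 + 1) = FreeGroup.of x := by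
  have hi1 := step_add_one_eq_inv_of hX hc hi
  obtain ⟨z, hz | hz⟩ := hc.exists_step_eq (i + 1 + 1)
  · have hzx : z ≠ 1 - x := by
      rintro rfl
      exact hc.step_add_one_ne (two_lt_of_step_eq_of hX hc hi).le (i + 1) (by rw [hz, hi1, inv_inv])
    rw [hz, eq_one_sub_of_ne hzx, sub_sub_cancel]
  · have hrev : step (fun k => c (-k)) (-(i + 1 + 1) - 1) = FreeGroup.of z := by
      rw [step_neg, show -(-(i + 1 + 1) - 1) - 1 = i + 1 + 1 by ring, hz, inv_inv]
    have hnext := step_add_one_eq_inv_of hX hc.reverse hrev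
    rw [step_neg, show -(-(i + 1 + 1) - 1 + 1) - 1 = i + 1 by ring, hi1, inv_inv] at hnext
    exact absurd hnext (of_ne_inv_of _ _)

theorem walk_add_two_mul_eq_mul_pow (hX : IsTwoEdgeCut f a X) (hc : IsShortestLoop f n c)
    (hi : step c i = FreeGroup.of x) (k : ℕ) :
    c (i + 2 * k) = c i * (FreeGroup.of x * (FreeGroup.of (1 - x))⁻¹) ^ k := by
  induction k generalizing i with
  | zero => simp
  | succ k ih =>
    have hi2 := step_add_two_eq_of hX hc hi
    rw [show i + 2 * ((k + 1 : ℕ) : ℤ) = i + 1 + 1 + 2 * k by push_cast; ring, ih hi2,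
      ← mul_step c, ← mul_step c i, hi, step_add_one_eq_inv_of hX hc hi, pow_succ']
    simp only [mul_assoc]

theorem isOfFinOrder_of_step_eq_of (hX : IsTwoEdgeCut f a X) (hc : IsShortestLoop f n c)
    (hi : step c i = FreeGroup.of x) : IsOfFinOrder (f x * (f (1 - x))⁻¹) := by
  refine isOfFinOrder_iff_pow_eq_one.2 ⟨n, hc.one_le, ?_⟩
  have hloop : FreeGroup.lift f (c (i + 2 * n)) = FreeGroup.lift f (c i) := by
    rw [two_mul, ← add_assoc, hc.lift_add, hc.lift_add]
  simpa [walk_add_two_mul_eq_mul_pow hX hc hi] using hloop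

theorem IsTwoEdgeCut.isOfFinOrder (hX : IsTwoEdgeCut f a X)
    (hf : ¬ Function.Injective (FreeGroup.lift f)) : IsOfFinOrder (f 0 * (f 1)⁻¹) := by
  obtain ⟨n, c, hc⟩ := exists_isShortestLoop hf
  obtain ⟨c, hc, i, x, hi⟩ : ∃ c, IsShortestLoop f n c ∧ ∃ i x, step c i = FreeGroup.of x := by
    obtain ⟨x, hx | hx⟩ := hc.exists_step_eq 0
    · exact ⟨c, hc, 0, x, hx⟩
    · exact ⟨_, hc.reverse, -1, x, by simp [step_neg, hx]⟩
  have hfin := isOfFinOrder_of_step_eq_of hX hc hi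
  fin_cases x
  · exact hfin
  · simpa using hfin.inv

end Alternation

section MainTheorem

variable {G : Type*} [Group G] {g h a b : G} {E : Set G}

theorem isTwoEdgeCut_of_smul_eq (ha : a ∈ E) (hb : b ∈ E) (hab : a ≠ b) (hg : g • E = E \ {a})
    (hh : h • E = E \ {b}) :
    IsTwoEdgeCut ![g, h] ![1, a * b⁻¹] {y | y⁻¹ * a ∈ E} where
  mem := by simp [Fin.forall_fin_two, ha, hb]
  leavesOnlyAt := by
    have hg1 := leavesOnlyAt_of_smul_eq hg a
    rw [mul_inv_cancel] at hg1
    exact Fin.forall_fin_two.2 ⟨hg1, leavesOnlyAt_of_smul_eq hh a⟩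
  ne := by
    have hne : a * b⁻¹ ≠ 1 := mul_inv_eq_one.not.2 hab
    exact Fin.forall_fin_two.2 ⟨hne.symm, hne⟩

theorem two_le_orderOf_of_smul_eq (hab : a ≠ b) (ha : a ∈ E) (hg : g • E = E \ {a})
    (hh : h • E = E \ {b}) (hfin : IsOfFinOrder (g * h⁻¹)) : 2 ≤ orderOf (h⁻¹ * g) := by
  have hpos := hfin.orderOf_pos
  rw [orderOf_mul_inv_eq_orderOf_inv_mul] at hpos
  have hne : orderOf (h⁻¹ * g) ≠ 1 := fun hone => by
    rw [orderOf_eq_one_iff, inv_mul_eq_one] at hone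
    have hmem : a ∈ E \ {a} := by
      rw [← hg, ← hone, hh]
      exact ⟨ha, hab⟩
    exact hmem.2 rfl
  omega

end MainTheorem

theorem mainTheorem1 {G : Type*} [Group G] (g h : G) (E : Set G) (hE : IsWSSubset g h E) :
    PairIsFree g h ∨
      ∃ k : ℕ, 2 ≤ k ∧
        PairHasPresentation g h {((FreeGroup.of 1)⁻¹ * FreeGroup.of 0) ^ k} := by
  obtain ⟨a, ha, b, hb, hab, hg, hh⟩ := hE
  by_cases hfree : Function.Injective (FreeGroup.lift ![g, h])
  · exact Or.inl (pairIsFree_of_injective hfree)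
  have hX := isTwoEdgeCut_of_smul_eq ha hb hab hg hh
  have hfin : IsOfFinOrder (g * h⁻¹) := hX.isOfFinOrder hfree
  obtain ⟨W, q, hq, hgW, hhW⟩ := exists_leavesOnlyAt_inv (hX.mem 0) (hX.mem 1) (hX.ne 1)
    (hX.leavesOnlyAt 0) (hX.leavesOnlyAt 1) hfin
  exact Or.inr ⟨_, two_le_orderOf_of_smul_eq hab ha hg hh hfin,
    pairHasPresentation_of_leavesOnlyAt_inv hq hgW hhW⟩
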